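/- Let $R$ be a GCD domain and let $G$ be a finite simple graph with vertices $v_1,\dots,v_n$ whose edges $e$ are labeled by nonzero elements $l_e\in R$ (that is, by the nonzero principal ideals $\alpha(e)=l_eR$). A spline on $(G,\alpha)$ is a vector $F=(f_1,\dots,f_n)\in R^n$ such that $f_i-f_j\in l_eR$ for every edge $e=v_iv_j$; the splines form an $R$-module $R_{(G,\alpha)}$. For $F_1,\dots,F_n\in R_{(G,\alpha)}$ let $|F_1\ \cdots\ F_n|$ be the determinant of the $n\times n$ matrix with columns $F_1,\dots,F_n$ (the entries of each column being listed from bottom to top). For a graph $H$ with edges labeled by elements of $R$ and with vertices ordered $w_1,\dots,w_m$, a zero trail of $w_i$ is a trail in $H$ (a walk without repeated edges) from $w_i$ to some $w_j$ with $j<i$. Define $$Q_H=\prod_{i=2}^{m}\operatorname{lcm}\{\gcd(\text{edge labels on }p) : p \text{ a zero trail of } w_i\},$$ where the greatest common divisors and least common multiples are chosen up to units. A diamond graph is a graph obtained by gluing two cycles along a common edge; cycles have length at least $3$. Suppose that $G$ is obtained by joining subgraphs $G_1,\dots,G_k$, each of which is a cycle, a diamond graph or a tree, along cut vertices: $G=G_1\cup\dots\cup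 G_k$ and, for each $i\ge 2$, the graph $G_i$ has exactly one vertex in common with $G_1\cup\dots\cup G_{i-1}$ (so that a vertex at which two pieces with at least two vertices each are joined is a cut vertex of $G$). Each $G_i$ carries the edge labels inherited from $G$, and the vertices of each $G_i$ are ordered arbitrarily. Then, for $F_1,\dots,F_n\in R_{(G,\alpha)}$, the elements $F_1,\dots,F_n$ form a basis of the $R$-module $R_{(G,\alpha)}$ if and only if $$|F_1\ \cdots\ F_n| = r\cdot Q_{G_1}\cdots Q_{G_k}\quad\text{for some unit } r\in R.$$ -/

import Mathlib

namespace GraphSpline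

/-- The `R`-module of generalized splines on a graph `G` whose edges are labeled by ideals `α e`:
vertex labelings `f` with `f u - f v ∈ α(uv)` for every edge `uv`.  The edge labeling is written as
a function on all unordered pairs; only its values on the edges of `G` are used. -/
def splineModule {R V : Type*} [CommRing R] (G : SimpleGraph V) (α : Sym2 V → Ideal R) :
    Submodule R (V → R) where
  carrier := {f | ∀ u v : V, G.Adj u v → f u - f v ∈ α s(u, v)}
  add_mem' := by
    intro f g hf hg u v h
    have := (α s(u, v)).add_mem (hf u v h) (hg u v h)
    simpa [add_sub_add_comm] using this
  zero_mem' := by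
    intro u v _
    simp
  smul_mem' := by
    intro c f hf u v h
    have := (α s(u, v)).mul_mem_left c (hf u v h)
    simpa [mul_sub] using this

/-- The matrix whose columns are the vertex labelings `F 0, …, F (n - 1)`, with the entries of each
column ordered from bottom to top along the vertex ordering `v 0, …, v (n - 1)`. -/
def splineMatrix {R V : Type*} {n : ℕ} (v : Fin n ≃ V) (F : Fin n → V → R) :
    Matrix (Fin n) (Fin n) R :=
  Matrix.of fun a b => F b (v a.rev)

/-- The edge sequences of the zero trails of the vertex `v a`: all trails of `G` from `v a` to a
vertex `v b` with `b < a` (the vertices that carry the label zero). -/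
def zeroTrails {V : Type*} {n : ℕ} (G : SimpleGraph V) (v : Fin n ≃ V) (a : Fin n) :
    Set (List (Sym2 V)) :=
  {L | ∃ b : Fin n, b < a ∧ ∃ p : G.Walk (v a) (v b), p.IsTrail ∧ p.edges = L}

theorem finite_zeroTrails {V : Type*} {n : ℕ} (G : SimpleGraph V) (v : Fin n ≃ V) (a : Fin n) :
    (zeroTrails G v a).Finite := by
  classical
  have : Fintype V := Fintype.ofEquiv _ v
  refine (List.finite_length_le (Sym2 V) (Fintype.card (Sym2 V))).subset ?_
  rintro L ⟨b, -, p, hp, rfl⟩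
  exact hp.edges_nodup.length_le_card

/-- A greatest common divisor of the entries of a finite list. -/
def listGcd {R : Type*} [CommRing R] [GCDMonoid R] (L : List R) : R :=
  L.foldr GCDMonoid.gcd 0

/-- A least common multiple of the entries of a finite list (`1` for the empty list). -/
def listLcm {R : Type*} [CommRing R] [GCDMonoid R] (L : List R) : R :=
  L.foldr GCDMonoid.lcm 1

/-- The element `Q_G` of a graph `G` with edge labels `l` and vertex ordering `v`: the product over
the vertices `v a` of the least common multiple, over all zero trails of `v a`, of the greatest
common divisor of the edge labels on the trail.  The first vertex has no zero trails and contributes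
the factor `1`. -/
noncomputable def elementQ {R V : Type*} [CommRing R] [GCDMonoid R] {n : ℕ}
    (G : SimpleGraph V) (l : Sym2 V → R) (v : Fin n ≃ V) : R :=
  ∏ a : Fin n,
    listLcm ((finite_zeroTrails G v a).toFinset.toList.map fun L => listGcd (L.map l))

/-- `G` is a cycle `C_n` for some `n ≥ 3`. -/
def IsCycleGraph {V : Type*} (G : SimpleGraph V) : Prop :=
  ∃ n : ℕ, 3 ≤ n ∧ Nonempty (G ≃g SimpleGraph.cycleGraph n)

/-- `G` is a diamond graph `D_{m,n}`: two cycles glued along a common edge. -/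
def IsDiamondGraph {V : Type*} (G : SimpleGraph V) : Prop :=
  ∃ (A B : G.Subgraph) (x y : V) (h : G.Adj x y),
    IsCycleGraph A.coe ∧ IsCycleGraph B.coe ∧ A ⊔ B = ⊤ ∧ A ⊓ B = G.subgraphOfAdj h

/-- `G` is obtained by joining the pieces `H 0, …, H (k - 1)` successively at single vertices:
the pieces cover all vertices and edges of `G`, and each piece after the first meets the union of
the preceding ones in exactly one vertex (and hence in no edge).  Every vertex at which two pieces
with at least two vertices each are joined is then a cut vertex of `G` separating them. -/
structure IsVertexJoin {V : Type*} {k : ℕ} (G : SimpleGraph V) (H : Fin k → G.Subgraph) :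
    Prop where
  cover : ⨆ i, H i = ⊤
  common : ∀ i : Fin k, 0 < i.val → ∃ x : V, (H i).verts ∩ ⋃ j < i, (H j).verts = {x}

/-- The edge labels that a subgraph inherits. -/
def restrictLabels {R V : Type*} {G : SimpleGraph V} (H : G.Subgraph) (l : Sym2 V → R) :
    Sym2 H.verts → R :=
  fun e => l (e.map Subtype.val)

end GraphSpline

/-!
For a finite graph `G` with nonzero edge labels in a GCD domain, `Q_G` is a greatest common divisor
of the determinants of all square families of splines (`isDetGcd_elementQ`).  By Cramer's rule a
family of splines is then a basis exactly when its determinant is a unit multiple of `Q_G`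
(`IsDetGcd.basis_iff`), even though the spline module need not be free.

Fix an ordering of the vertices and let `β u` be the factor of `Q_G` at `u`.  Along a zero trail
from `u` to `b` every spline `f` satisfies `f u ≡ f b` modulo the gcd of the labels; subtracting row
`b` from row `u` makes that gcd a common factor of row `u`, so the product of the `β u` divides
every determinant.  Conversely, let `C` be a set of vertices containing `u` and no earlier vertex.
The indicator function of `C`, times the lcm of the labels on the boundary of `C`, is a spline that
vanishes before `u`.  A bottleneck version of the max-flow min-cut theorem, valid because the
divisibility lattice is distributive, says that the gcd over all `C` of these lcms is `β u`
(`dvd_trailLcm_of_forall_cut`), and triangular families of such splines show that no proper multiple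
of the product of the `β u` divides all determinants (`isDetGcd_prod_of_isPivot`).

As a gcd of determinants, `Q_G` does not depend on the ordering up to units.  When `G` is joined
from pieces at single vertices, each piece may therefore be ordered with its attaching vertex
first, and the vertices of `G` be ranked piece by piece.  Splines on a piece that vanish at its
attaching vertex extend to `G`, so the factors of the pieces also serve as factors for `G`, and the
product of the `Q_{G_i}` is the gcd of the determinants for `G` (`IsVertexJoin.isDetGcd`).
-/

namespace GraphSpline

/-! ### Greatest common divisors and least common multiples of lists -/

section GCD

variable {R : Type*} [CommRing R] [GCDMonoid R]

theorem listGcd_dvd {L : List R} {x : R} (hx : x ∈ L) : listGcd L ∣ x := by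
  induction L with
  | nil => simp at hx
  | cons y L ih =>
    rcases List.mem_cons.1 hx with rfl | h
    · exact gcd_dvd_left _ _
    · exact (gcd_dvd_right _ _).trans (ih h)

theorem dvd_listGcd {L : List R} {d : R} (h : ∀ x ∈ L, d ∣ x) : d ∣ listGcd L := by
  induction L with
  | nil => exact dvd_zero d
  | cons y L ih =>
    exact dvd_gcd (h y (by simp)) (ih fun x hx => h x (by simp [hx]))

theorem dvd_listLcm {L : List R} {x : R} (hx : x ∈ L) : x ∣ listLcm L := by
  induction L with
  | nil => simp at hx
  | cons y L ih =>
    rcases List.mem_cons.1 hx with rfl | h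
    · exact dvd_lcm_left _ _
    · exact (ih h).trans (dvd_lcm_right _ _)

theorem listLcm_dvd {L : List R} {c : R} (h : ∀ x ∈ L, x ∣ c) : listLcm L ∣ c := by
  induction L with
  | nil => exact one_dvd c
  | cons y L ih =>
    exact lcm_dvd (h y (by simp)) (ih fun x hx => h x (by simp [hx]))

theorem listLcm_ne_zero [IsDomain R] {L : List R} (h : ∀ x ∈ L, x ≠ 0) : listLcm L ≠ 0 := by
  induction L with
  | nil => exact one_ne_zero
  | cons y L ih =>
    intro h0
    rcases (lcm_eq_zero_iff y (listLcm L)).1 h0 with h1 | h1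
    · exact h y (by simp) h1
    · exact ih (fun x hx => h x (by simp [hx])) h1

/-- The divisibility lattice of a GCD domain is distributive. -/
theorem gcd_lcm_dvd_lcm_gcd [IsDomain R] (y a b : R) :
    gcd y (lcm a b) ∣ lcm (gcd y a) (gcd y b) := by
  by_cases h0 : gcd (gcd y a) (gcd y b) = 0
  · have hy : gcd y a = 0 := ((gcd_eq_zero_iff _ _).1 h0).1
    rw [hy, lcm_zero_left]
    exact dvd_zero _
  -- After multiplication by `gcd (gcd y a) (gcd y b)` the right-hand side becomes
  -- `gcd y a * gcd y b`, the gcd of the four products `y * y`, `y * b`, `a * y`, `a * b`.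
  rw [← mul_dvd_mul_iff_left h0]
  refine Dvd.dvd.trans ?_ (gcd_mul_lcm (gcd y a) (gcd y b)).symm.dvd
  have hy : gcd y (lcm a b) ∣ y := gcd_dvd_left _ _
  have gy : gcd (gcd y a) (gcd y b) ∣ y := (gcd_dvd_left _ _).trans (gcd_dvd_left _ _)
  have ga : gcd (gcd y a) (gcd y b) ∣ a := (gcd_dvd_left _ _).trans (gcd_dvd_right _ _)
  have gb : gcd (gcd y a) (gcd y b) ∣ b := (gcd_dvd_right _ _).trans (gcd_dvd_right _ _)
  have key : ∀ z, gcd (gcd y a) (gcd y b) * gcd y (lcm a b) ∣ y * z →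
      gcd (gcd y a) (gcd y b) * gcd y (lcm a b) ∣ a * z →
      gcd (gcd y a) (gcd y b) * gcd y (lcm a b) ∣ gcd y a * z := fun z h1 h2 =>
    (dvd_gcd h1 h2).trans (gcd_mul_right' z y a).dvd
  refine (dvd_gcd (key y ?_ ?_) (key b ?_ ?_)).trans (gcd_mul_left' (gcd y a) y b).dvd
  · exact mul_dvd_mul gy hy
  · exact mul_dvd_mul ga hy
  · rw [mul_comm y b]; exact mul_dvd_mul gb hy
  · exact (mul_dvd_mul (dvd_gcd ga gb) (gcd_dvd_right _ _)).trans (gcd_mul_lcm a b).dvd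

theorem gcd_listLcm_dvd [IsDomain R] {L : List R} {y c : R} (h : ∀ x ∈ L, gcd y x ∣ c) :
    gcd y (listLcm L) ∣ c := by
  induction L with
  | nil => exact (gcd_dvd_right y (1 : R)).trans (one_dvd c)
  | cons x L ih =>
    exact (gcd_lcm_dvd_lcm_gcd y x (listLcm L)).trans
      (lcm_dvd (h x (by simp)) (ih fun z hz => h z (by simp [hz])))

/-- Taking a greatest common divisor commutes with multiplication by `c`: a divisor of all products
`c * z` divides `c * β` as soon as every common divisor of the elements `z` divides `β`. -/
theorem dvd_mul_of_forall_dvd_mul [IsDomain R] {Z : Set R} {D c β : R}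
    (hβ : ∀ d, (∀ z ∈ Z, d ∣ z) → d ∣ β) (h : ∀ z ∈ Z, D ∣ c * z) : D ∣ c * β := by
  by_cases hc : c = 0
  · simp [hc]
  obtain ⟨d, c', hd, hc', hu⟩ := extract_gcd D c
  have hg : gcd D c ≠ 0 := fun h0 => hc ((gcd_eq_zero_iff _ _).1 h0).2
  have hrel : IsRelPrime d c' := fun t h1 h2 => isUnit_of_dvd_unit (dvd_gcd h1 h2) hu
  generalize gcd D c = g at hd hc' hg
  subst hd hc'
  rw [mul_assoc]
  refine mul_dvd_mul_left g (dvd_mul_of_dvd_right (hβ d fun z hz => ?_) c')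
  refine hrel.dvd_of_dvd_mul_left ((mul_dvd_mul_iff_left hg).1 ?_)
  rw [← mul_assoc]
  exact h z hz

end GCD

/-! ### Pivots and determinants -/

section Pivot

variable {R V : Type*} [CommRing R]

/-- `β` is a pivot of the module `M` of functions `V → R` at `u`, with respect to a ranking `ρ` of
`V`.  The first condition (`dvd_of_forall`) bounds `β` above in the divisibility order: `β` divides
every common multiple of the elements `g` for which `f u ≡ f b` modulo `g` holds on `M` for some
`b` of smaller rank.  The second (`forall_dvd`) bounds it below: every common divisor of the values
`f u` of the elements `f` of `M` that vanish at all `b` of smaller rank divides `β`. -/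
structure IsPivot {κ : Type*} [LT κ] (M : Submodule R (V → R)) (ρ : V → κ) (u : V) (β : R) :
    Prop where
  dvd_of_forall : ∀ c, (∀ g b, ρ b < ρ u → (∀ f ∈ M, g ∣ f u - f b) → g ∣ c) → β ∣ c
  forall_dvd : ∀ d, (∀ f ∈ M, (∀ b, ρ b < ρ u → f b = 0) → d ∣ f u) → d ∣ β

/-- The square matrix with columns `F w`, rows and columns being indexed by the same type. -/
def colMatrix (F : V → V → R) : Matrix V V R := Matrix.of fun u w => F w u

/-- `q` is a greatest common divisor of the determinants of all families, indexed by `V`, of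
elements of the module `M` of functions `V → R`. -/
structure IsDetGcd [Fintype V] [DecidableEq V] (M : Submodule R (V → R)) (q : R) : Prop where
  dvd_det : ∀ F : V → V → R, (∀ w, F w ∈ M) → q ∣ (colMatrix F).det
  dvd_of_forall : ∀ D, (∀ F : V → V → R, (∀ w, F w ∈ M) → D ∣ (colMatrix F).det) → D ∣ q

theorem IsDetGcd.associated [IsDomain R] [Fintype V] [DecidableEq V] {M : Submodule R (V → R)}
    {q q' : R} (h : IsDetGcd M q) (h' : IsDetGcd M q') : Associated q q' :=
  associated_of_dvd_dvd (h'.dvd_of_forall q h.dvd_det) (h.dvd_of_forall q' h'.dvd_det)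

theorem IsDetGcd.of_associated [Fintype V] [DecidableEq V] {M : Submodule R (V → R)}
    {q q' : R} (h : IsDetGcd M q) (hq : Associated q q') : IsDetGcd M q' where
  dvd_det F hF := hq.dvd'.trans (h.dvd_det F hF)
  dvd_of_forall D hD := (h.dvd_of_forall D hD).trans hq.dvd

variable [Fintype V] [DecidableEq V] {κ : Type*} [LinearOrder κ]

/-- If every row `u` of a matrix is divisible by `g u`, possibly after subtraction of a row of
smaller rank, then the product of the `g u` divides the determinant: the row operations form a
unitriangular matrix. -/
theorem prod_dvd_det (A : Matrix V V R) {ρ : V → κ} (hρ : Function.Injective ρ) (g : V → R)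
    (hg : ∀ u, g u = 1 ∨ ∃ b, ρ b < ρ u ∧ ∀ w, g u ∣ A u w - A b w) : ∏ u, g u ∣ A.det := by
  have : ∀ u, ∃ (t : V → R), (∀ w, ρ u ≤ ρ w → t w = if u = w then 1 else 0) ∧
      ∀ w, g u ∣ ∑ x, t x * A x w := by
    intro u
    rcases hg u with h | ⟨b, hb, h⟩
    · exact ⟨fun w => if u = w then 1 else 0, fun w _ => rfl, fun w => by rw [h]; exact one_dvd _⟩
    · refine ⟨fun w => (if u = w then 1 else 0) - if b = w then 1 else 0, fun w hw => ?_,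
        fun w => ?_⟩
      · have : b ≠ w := by rintro rfl; exact absurd hb (not_lt.2 hw)
        simp [this]
      · simpa [sub_mul, Finset.sum_sub_distrib] using h w
  choose t ht hd using this
  choose K hK using hd
  have hdet : (Matrix.of t).det = 1 := by
    let _ : LinearOrder V := LinearOrder.lift' ρ hρ
    have htri : (Matrix.of t).IsLowerTriangular := by
      intro i j hij
      have hij' : ρ i < ρ j := hij
      rw [Matrix.of_apply, ht i j hij'.le, if_neg (by rintro rfl; exact lt_irrefl _ hij')]
    rw [Matrix.det_of_isLowerTriangular _ htri]
    exact Finset.prod_eq_one fun u _ => by simp [ht u u le_rfl]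
  have hmul : Matrix.of t * A = Matrix.of fun u w => g u * Matrix.of K u w := by
    ext u w
    simp [Matrix.mul_apply, hK]
  have := congrArg Matrix.det hmul
  rw [Matrix.det_mul, hdet, one_mul, Matrix.det_mul_column] at this
  exact ⟨_, this⟩

/-- The product of pivots at all elements is the gcd of the determinants.  It divides each of them
by row operations, and the families that are triangular with respect to the ranking show that
nothing larger does. -/
theorem isDetGcd_prod_of_isPivot [IsDomain R] [GCDMonoid R] {M : Submodule R (V → R)} {ρ : V → κ}
    (hρ : Function.Injective ρ) {β : V → R} (hβ : ∀ u, IsPivot M ρ u (β u)) :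
    IsDetGcd M (∏ u, β u) where
  dvd_det F hF := by
    let P : V → R → Prop := fun u g => g = 1 ∨ ∃ b, ρ b < ρ u ∧ ∀ f ∈ M, g ∣ f u - f b
    -- The factors at the elements of `S` have already been replaced by pivots.
    have key : ∀ S : Finset V, ∀ g : V → R, (∀ u ∈ S, g u = β u) → (∀ u ∉ S, P u (g u)) →
        ∏ u, g u ∣ (colMatrix F).det := by
      intro S
      induction S using Finset.induction_on with
      | empty =>
        intro g _ h2
        refine prod_dvd_det _ hρ g fun u => (h2 u (by simp)).imp id ?_
        rintro ⟨b, hb, h⟩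
        exact ⟨b, hb, fun w => h _ (hF w)⟩
      | insert a S ha ih =>
        intro g h1 h2
        set c := ∏ u ∈ Finset.univ.erase a, g u
        have hall : ∀ z, P a z → c * z ∣ (colMatrix F).det := by
          intro z hz
          have := ih (Function.update g a z) (fun u hu => ?_) (fun u hu => ?_)
          · rw [← Finset.prod_erase_mul _ _ (Finset.mem_univ a), Function.update_self] at this
            convert this using 2
            exact Finset.prod_congr rfl fun u hu => by
              rw [Function.update_of_ne (Finset.ne_of_mem_erase hu)]
          · rw [Function.update_of_ne (by rintro rfl; exact ha hu), h1 u (by simp [hu])]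
          · by_cases hua : u = a
            · subst hua; simpa using hz
            · rw [Function.update_of_ne hua]
              exact h2 u (by simp [hua, hu])
        rw [← Finset.prod_erase_mul _ _ (Finset.mem_univ a), h1 a (by simp)]
        obtain ⟨D, hD⟩ := (mul_one c).symm.dvd.trans (hall 1 (Or.inl rfl))
        by_cases hc : c = 0
        · rw [hD, hc, zero_mul]; exact dvd_zero _
        rw [hD]
        refine mul_dvd_mul_left c ((hβ a).dvd_of_forall D fun z b hb hz => ?_)
        have := hall z (Or.inr ⟨b, hb, hz⟩)
        rwa [hD, mul_dvd_mul_iff_left hc] at this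
    exact key Finset.univ β (fun _ _ => rfl) (fun u hu => absurd (Finset.mem_univ u) hu)
  dvd_of_forall D hD := by
    let Z : V → Set R := fun u => {z | ∃ f ∈ M, (∀ b, ρ b < ρ u → f b = 0) ∧ f u = z}
    have key : ∀ S : Finset V, ∀ z : V → R, (∀ u ∈ S, z u = β u) → (∀ u ∉ S, z u ∈ Z u) →
        D ∣ ∏ u, z u := by
      intro S
      induction S using Finset.induction_on with
      | empty =>
        intro z _ h2
        choose f hfM hf0 hf1 using fun u => h2 u (by simp)
        have := hD f hfM
        let _ : LinearOrder V := LinearOrder.lift' ρ hρ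
        have htri : (colMatrix f).IsLowerTriangular := by
          intro i j hij
          exact hf0 j i hij
        rw [Matrix.det_of_isLowerTriangular _ htri] at this
        simpa [colMatrix, hf1] using this
      | insert a S ha ih =>
        intro z h1 h2
        rw [← Finset.prod_erase_mul _ _ (Finset.mem_univ a), h1 a (by simp)]
        refine dvd_mul_of_forall_dvd_mul (Z := Z a) (fun d hd => (hβ a).forall_dvd d fun f hf h0 =>
          hd _ ⟨f, hf, h0, rfl⟩) fun y hy => ?_
        have := ih (Function.update z a y) (fun u hu => ?_) (fun u hu => ?_)
        · rw [← Finset.prod_erase_mul _ _ (Finset.mem_univ a), Function.update_self] at this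
          convert this using 2
          exact Finset.prod_congr rfl fun u hu => by
            rw [Function.update_of_ne (Finset.ne_of_mem_erase hu)]
        · rw [Function.update_of_ne (by rintro rfl; exact ha hu), h1 u (by simp [hu])]
        · by_cases hua : u = a
          · subst hua; simpa using hy
          · rw [Function.update_of_ne hua]
            exact h2 u (by simp [hua, hu])
    exact key Finset.univ β (fun _ _ => rfl) (fun u hu => absurd (Finset.mem_univ u) hu)

/-- Cramer's rule: a family in `M` is a basis if and only if its determinant generates the ideal
of the gcd of all determinants. -/
theorem IsDetGcd.basis_iff [IsDomain R] {M : Submodule R (V → R)} {q : R} (hq : IsDetGcd M q)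
    (hq0 : q ≠ 0) (F : V → M) :
    (LinearIndependent R F ∧ Submodule.span R (Set.range F) = ⊤) ↔
      Associated q (colMatrix fun w => (F w : V → R)).det := by
  constructor
  · rintro ⟨-, hspan⟩
    refine associated_of_dvd_dvd (hq.dvd_det _ fun w => (F w).2) (hq.dvd_of_forall _ fun F' hF' => ?_)
    have hc : ∀ w, ∃ c : V → R, ∑ x, c x • F x = ⟨F' w, hF' w⟩ := fun w => by
      rw [← Submodule.mem_span_range_iff_exists_fun, hspan]
      trivial
    choose c hc using hc
    have : colMatrix F' = colMatrix (fun w => (F w : V → R)) * Matrix.of fun x w => c w x := by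
      ext u w
      have := congrFun (congrArg Subtype.val (hc w)) u
      simp only [Submodule.coe_sum, Submodule.coe_smul, Finset.sum_apply, Pi.smul_apply,
        smul_eq_mul] at this
      simp [colMatrix, Matrix.mul_apply, ← this, mul_comm]
    rw [this, Matrix.det_mul]
    exact dvd_mul_right _ _
  · intro h
    set A := colMatrix fun w => (F w : V → R) with hA
    have hdet : A.det ≠ 0 := h.ne_zero_iff.1 hq0
    constructor
    · refine LinearIndependent.of_comp M.subtype ?_
      exact Matrix.linearIndependent_cols_of_det_ne_zero hdet
    · refine eq_top_iff.2 fun f _ => ?_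
      rw [Submodule.mem_span_range_iff_exists_fun]
      have : ∀ w, A.det ∣ A.cramer f w := by
        intro w
        refine h.dvd'.trans ?_
        rw [Matrix.cramer_apply]
        have : A.updateCol w f = colMatrix (Function.update (fun x => (F x : V → R)) w f) := by
          ext i j
          by_cases hj : j = w
          · subst hj; simp [colMatrix]
          · simp [colMatrix, hA, hj]
        rw [this]
        refine hq.dvd_det _ fun x => ?_
        by_cases hx : x = w
        · subst hx; simp
        · simp [hx]
      choose c hc using this
      refine ⟨c, Subtype.ext ?_⟩
      funext u
      have := congrFun (Matrix.mulVec_cramer A f) u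
      simp only [Matrix.mulVec, dotProduct, hc, Pi.smul_apply, smul_eq_mul] at this
      refine mul_left_cancel₀ hdet (Eq.trans ?_ this)
      simp only [Submodule.coe_sum, Submodule.coe_smul, Finset.sum_apply, Pi.smul_apply,
        smul_eq_mul, Finset.mul_sum]
      refine Finset.sum_congr rfl fun x _ => ?_
      simp only [hA, colMatrix, Matrix.of_apply]
      ring

end Pivot

/-! ### Zero trails and cuts -/

section ZeroTrails

variable {R V : Type*} [CommRing R]

theorem mem_splineModule_span {G : SimpleGraph V} {l : Sym2 V → R} {f : V → R} :
    f ∈ splineModule G (fun e => Ideal.span {l e}) ↔ ∀ u v, G.Adj u v → l s(u, v) ∣ f u - f v := by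
  simp only [← Ideal.mem_span_singleton]
  rfl

/-- A common multiple of the labels of a cut, times the indicator function of the cut, is a
spline. -/
theorem indicator_mem_splineModule {G : SimpleGraph V} {l : Sym2 V → R} {C : Set V} {c : R}
    (hc : ∀ x y, x ∈ C → y ∉ C → G.Adj x y → l s(x, y) ∣ c) :
    C.indicator (fun _ => c) ∈ splineModule G fun e => Ideal.span {l e} := by
  refine mem_splineModule_span.2 fun x y hxy => ?_
  by_cases hx : x ∈ C <;> by_cases hy : y ∈ C
  · simp [hx, hy]
  · simpa [hx, hy] using hc x y hx hy hxy
  · simpa [hx, hy, Sym2.eq_swap] using hc y x hy hx hxy.symm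
  · simp [hx, hy]

variable [GCDMonoid R] {n : ℕ}

/-- The factor of `elementQ` at the vertex `v a`. -/
noncomputable def trailLcm (G : SimpleGraph V) (l : Sym2 V → R) (v : Fin n ≃ V) (a : Fin n) : R :=
  listLcm ((finite_zeroTrails G v a).toFinset.toList.map fun L => listGcd (L.map l))

theorem listGcd_edges_dvd_sub {G : SimpleGraph V} {l : Sym2 V → R} {f : V → R}
    (hf : ∀ u v, G.Adj u v → l s(u, v) ∣ f u - f v) {u v : V} (p : G.Walk u v) :
    listGcd (p.edges.map l) ∣ f u - f v := by
  have key : ∀ d, (∀ e ∈ p.edges, d ∣ l e) → d ∣ f u - f v := by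
    intro d hd
    induction p with
    | nil => simp
    | @cons u x v h p ih =>
      have h1 : d ∣ f u - f x := (hd _ (by simp)).trans (hf _ _ h)
      have h2 : d ∣ f x - f v := ih fun e he => hd e (by simp [he])
      simpa using dvd_add h1 h2
  exact key _ fun e he => listGcd_dvd (List.mem_map_of_mem he)

theorem listGcd_dvd_trailLcm {G : SimpleGraph V} {l : Sym2 V → R} {v : Fin n ≃ V} {a b : Fin n}
    (hb : b < a) {p : G.Walk (v a) (v b)} (hp : p.IsTrail) :
    listGcd (p.edges.map l) ∣ trailLcm G l v a :=
  dvd_listLcm <| List.mem_map.2 ⟨p.edges, by simpa using ⟨b, hb, p, hp, rfl⟩, rfl⟩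

theorem trailLcm_dvd {G : SimpleGraph V} {l : Sym2 V → R} {v : Fin n ≃ V} {a : Fin n} {c : R}
    (h : ∀ b < a, ∀ p : G.Walk (v a) (v b), listGcd (p.edges.map l) ∣ c) :
    trailLcm G l v a ∣ c := by
  refine listLcm_dvd fun x hx => ?_
  obtain ⟨L, hL, rfl⟩ := List.mem_map.1 hx
  have hL' : L ∈ zeroTrails G v a := by simpa using hL
  obtain ⟨b, hb, p, -, rfl⟩ := hL'
  exact h b hb p

theorem trailLcm_eq_one {G : SimpleGraph V} {l : Sym2 V → R} {v : Fin n ≃ V} {a : Fin n}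
    (h : ∀ b, ¬ b < a) : trailLcm G l v a = 1 := by
  have : (finite_zeroTrails G v a).toFinset = ∅ := by
    rw [Set.Finite.toFinset_eq_empty, Set.eq_empty_iff_forall_notMem]
    rintro L ⟨b, hb, -⟩
    exact h b hb
  simp [trailLcm, this, listLcm]

theorem trailLcm_ne_zero [IsDomain R] {G : SimpleGraph V} {l : Sym2 V → R}
    (hl : ∀ e ∈ G.edgeSet, l e ≠ 0) (v : Fin n ≃ V) (a : Fin n) : trailLcm G l v a ≠ 0 := by
  refine listLcm_ne_zero fun x hx => ?_
  obtain ⟨L, hL, rfl⟩ := List.mem_map.1 hx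
  have hL' : L ∈ zeroTrails G v a := by simpa using hL
  obtain ⟨b, hb, p, -, rfl⟩ := hL'
  intro h0
  cases hp : p.edges with
  | nil =>
    have := SimpleGraph.Walk.edges_eq_nil.1 hp
    exact hb.ne (v.injective this.eq).symm
  | cons e L =>
    have he : e ∈ p.edges := by simp [hp]
    have := listGcd_dvd (List.mem_map_of_mem (f := l) he)
    rw [h0, zero_dvd_iff] at this
    exact hl e (p.edges_subset_edgeSet he) this

/-- Bottleneck duality.  If `d` divides the least common multiple of the labels of each cut `C`
that separates `v a` from the vertices before it, then `d` divides the least common multiple of the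
greatest common divisors of the labels on the zero trails of `v a`. -/
theorem dvd_trailLcm_of_forall_cut [IsDomain R] {G : SimpleGraph V} {l : Sym2 V → R}
    {v : Fin n ≃ V} {a : Fin n} {d : R}
    (h : ∀ C : Set V, v a ∈ C → (∀ b < a, v b ∉ C) →
      ∀ c, (∀ x y, x ∈ C → y ∉ C → G.Adj x y → l s(x, y) ∣ c) → d ∣ c) :
    d ∣ trailLcm G l v a := by
  classical
  have : Fintype V := Fintype.ofEquiv _ v
  -- Grow `C` by the end points of its boundary edges, replacing the divisor `y` of `d` by its gcd
  -- with the label; `y` always divides all labels on suitable walks from `v a` to the points of `C`.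
  have key : ∀ (C : Finset V) (y : R), v a ∈ C → y ∣ d →
      (∀ w ∈ C, ∃ p : G.Walk (v a) w, ∀ e ∈ p.edges, y ∣ l e) → y ∣ trailLcm G l v a := by
    intro C
    induction hk : Cᶜ.card using Nat.strong_induction_on generalizing C with
    | _ k ih =>
      intro y haC hyd hy
      by_cases hb : ∃ b < a, v b ∈ C
      · obtain ⟨b, hb, hbC⟩ := hb
        obtain ⟨p, hp⟩ := hy _ hbC
        refine Dvd.dvd.trans (dvd_listGcd ?_)
          (listGcd_dvd_trailLcm hb p.bypass_isPath.isTrail)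
        intro x hx
        obtain ⟨e, he, rfl⟩ := List.mem_map.1 hx
        exact hp e (p.edges_bypass_subset_edges he)
      push Not at hb
      let E : Finset (V × V) := {e | e.1 ∈ C ∧ e.2 ∉ C ∧ G.Adj e.1 e.2}
      let L : List R := E.toList.map fun e => l s(e.1, e.2)
      have hyL : y ∣ listLcm L := hyd.trans <| h C haC hb _ fun x z hx hz hxz =>
        dvd_listLcm (List.mem_map.2 ⟨(x, z), by simp [E, hxz] at *; exact ⟨hx, hz⟩, rfl⟩)
      refine (dvd_gcd dvd_rfl hyL).trans (gcd_listLcm_dvd fun t ht => ?_)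
      obtain ⟨⟨x, z⟩, he, rfl⟩ := List.mem_map.1 ht
      obtain ⟨hx, hz, hxz⟩ : x ∈ C ∧ z ∉ C ∧ G.Adj x z := by simpa [E] using he
      refine ih _ ?_ (insert z C) rfl _ (by simp [haC]) ((gcd_dvd_left _ _).trans hyd) ?_
      · rw [← hk]
        refine Finset.card_lt_card (Finset.compl_ssubset_compl.2 (Finset.ssubset_insert hz))
      · intro w hw
        rcases Finset.mem_insert.1 hw with rfl | hw
        · obtain ⟨p, hp⟩ := hy x hx
          refine ⟨p.concat hxz, fun e he => ?_⟩
          rw [SimpleGraph.Walk.edges_concat, List.concat_eq_append, List.mem_append] at he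
          rcases he with he | he
          · exact (gcd_dvd_left _ _).trans (hp e he)
          · obtain rfl := List.mem_singleton.1 he
            exact gcd_dvd_right _ _
        · obtain ⟨p, hp⟩ := hy w hw
          exact ⟨p, fun e he => (gcd_dvd_left _ _).trans (hp e he)⟩
  refine key {v a} d (by simp) dvd_rfl fun w hw => ?_
  obtain rfl := Finset.mem_singleton.1 hw
  exact ⟨.nil, by simp⟩

theorem isPivot_trailLcm [IsDomain R] (G : SimpleGraph V) (l : Sym2 V → R) (v : Fin n ≃ V)
    (u : V) :
    IsPivot (splineModule G fun e => Ideal.span {l e}) v.symm u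
      (trailLcm G l v (v.symm u)) where
  dvd_of_forall c hc := trailLcm_dvd fun b hb p => hc _ (v b) (by simpa using hb) fun f hf => by
    simpa using listGcd_edges_dvd_sub (mem_splineModule_span.1 hf) p
  forall_dvd d hd := dvd_trailLcm_of_forall_cut fun C hC hbC c hc => by
    have := hd _ (indicator_mem_splineModule hc) fun b hb =>
      Set.indicator_of_notMem (by simpa using hbC _ hb) _
    rw [v.apply_symm_apply] at hC
    rwa [Set.indicator_of_mem hC] at this

theorem isDetGcd_elementQ [IsDomain R] [Fintype V] [DecidableEq V] (G : SimpleGraph V)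
    (l : Sym2 V → R) (v : Fin n ≃ V) :
    IsDetGcd (splineModule G fun e => Ideal.span {l e}) (elementQ G l v) := by
  have := isDetGcd_prod_of_isPivot v.symm.injective (isPivot_trailLcm G l v)
  rwa [Equiv.prod_comp v.symm (trailLcm G l v)] at this

/-- The element `Q_G` does not depend on the vertex ordering, up to units. -/
theorem associated_elementQ [IsDomain R] {n' : ℕ} (G : SimpleGraph V) (l : Sym2 V → R)
    (v : Fin n ≃ V) (v' : Fin n' ≃ V) : Associated (elementQ G l v) (elementQ G l v') := by
  classical
  have : Fintype V := Fintype.ofEquiv _ v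
  exact (isDetGcd_elementQ G l v).associated (isDetGcd_elementQ G l v')

end ZeroTrails

/-! ### Joining pieces at single vertices -/

section Join

variable {R V : Type*} [CommRing R] {k : ℕ} {G : SimpleGraph V} {H : Fin k → G.Subgraph}

theorem IsVertexJoin.eq_of_mem (hG : IsVertexJoin G H) {i : Fin k} {x y : V}
    (hx : x ∈ (H i).verts) (hx' : ∃ j < i, x ∈ (H j).verts)
    (hy : y ∈ (H i).verts) (hy' : ∃ j < i, y ∈ (H j).verts) : x = y := by
  obtain ⟨j, hj, -⟩ := id hx'
  obtain ⟨z, hz⟩ := hG.common i (lt_of_le_of_lt (Nat.zero_le j.val) hj)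
  have h1 : x ∈ (H i).verts ∩ ⋃ j < i, (H j).verts := ⟨hx, by simpa using hx'⟩
  have h2 : y ∈ (H i).verts ∩ ⋃ j < i, (H j).verts := ⟨hy, by simpa using hy'⟩
  rw [hz] at h1 h2
  exact h1.trans h2.symm

/-- A spline on the piece `H i` that vanishes on the preceding pieces extends to a spline on `G`:
each later piece receives the constant value at the vertex where it is attached. -/
theorem IsVertexJoin.exists_extension (hG : IsVertexJoin G H) {l : Sym2 V → R} {i : Fin k}
    {f : V → R} (hf : ∀ x y, (H i).Adj x y → l s(x, y) ∣ f x - f y)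
    (hf0 : ∀ j < i, ∀ x ∈ (H j).verts, f x = 0) :
    ∃ f' ∈ splineModule G fun e => Ideal.span {l e},
      ∀ j ≤ i, ∀ x ∈ (H j).verts, f' x = f x := by
  classical
  have key : ∀ m : ℕ, i.val + 1 ≤ m → m ≤ k → ∃ f' : V → R,
      (∀ j : Fin k, j.val < m → ∀ x y, (H j).Adj x y → l s(x, y) ∣ f' x - f' y) ∧
      ∀ j ≤ i, ∀ x ∈ (H j).verts, f' x = f x := by
    intro m hm
    induction m, hm using Nat.le_induction with
    | base =>
      refine fun _ => ⟨f, fun j hj x y hxy => ?_, fun _ _ _ _ => rfl⟩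
      rcases (show j ≤ i from Nat.lt_succ_iff.1 hj).lt_or_eq with hj | rfl
      · simp [hf0 j hj x ((H j).edge_vert hxy), hf0 j hj y ((H j).edge_vert hxy.symm)]
      · exact hf x y hxy
    | succ m hm ih =>
      intro hmk
      obtain ⟨f', hf', hf'f⟩ := ih (Nat.le_of_succ_le hmk)
      obtain ⟨z, hz⟩ := hG.common ⟨m, hmk⟩ (Nat.lt_of_lt_of_le (Nat.succ_pos _) hm)
      refine ⟨fun x => if ∃ j : Fin k, j.val < m ∧ x ∈ (H j).verts then f' x else f' z,
        fun j hj x y hxy => ?_, fun j hj x hx => ?_⟩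
      · rcases (Nat.lt_succ_iff.1 hj).lt_or_eq with hj | hj
        · simp only
          rw [if_pos ⟨j, hj, (H j).edge_vert hxy⟩, if_pos ⟨j, hj, (H j).edge_vert hxy.symm⟩]
          exact hf' j hj x y hxy
        · obtain rfl : j = ⟨m, hmk⟩ := Fin.ext hj
          have hconst : ∀ x ∈ (H ⟨m, hmk⟩).verts,
              (if ∃ j : Fin k, j.val < m ∧ x ∈ (H j).verts then f' x else f' z) = f' z := by
            intro x hx
            split_ifs with h
            · have : x ∈ (H ⟨m, hmk⟩).verts ∩ ⋃ j < (⟨m, hmk⟩ : Fin k), (H j).verts :=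
                ⟨hx, by simpa [Fin.lt_def] using h⟩
              rw [hz, Set.mem_singleton_iff] at this
              rw [this]
            · rfl
          simp only
          rw [hconst x ((H _).edge_vert hxy), hconst y ((H _).edge_vert hxy.symm), sub_self]
          exact dvd_zero _
      · simp only
        rw [if_pos ⟨j, Nat.lt_of_le_of_lt hj hm, hx⟩, hf'f j hj x hx]
  obtain ⟨f', hf', hf'f⟩ := key k i.isLt le_rfl
  refine ⟨f', mem_splineModule_span.2 fun x y hxy => ?_, hf'f⟩
  have : (⨆ i, H i).Adj x y := by rw [hG.cover]; exact hxy
  obtain ⟨j, hj⟩ := SimpleGraph.Subgraph.iSup_adj.1 this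
  exact hf' j j.isLt x y hj

/-- The vertices of each piece can be reordered so that the vertex shared with the preceding pieces
becomes the first one. -/
theorem IsVertexJoin.exists_ordering (hG : IsVertexJoin G H) {m : ℕ} {i : Fin k}
    (w : Fin m ≃ (H i).verts) :
    ∃ w' : Fin m ≃ (H i).verts, ∀ x, (∃ j < i, x.1 ∈ (H j).verts) → ∀ a, ¬ a < w'.symm x := by
  by_cases h : ∃ x : (H i).verts, ∃ j < i, x.1 ∈ (H j).verts
  · obtain ⟨z, hz⟩ := h
    have hm : 0 < m := Fin.pos (w.symm z)
    refine ⟨(Equiv.swap ⟨0, hm⟩ (w.symm z)).trans w, fun x hx a ha => ?_⟩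
    obtain rfl : x = z := Subtype.ext (hG.eq_of_mem x.2 hx z.2 hz)
    rw [Equiv.symm_trans_apply, Equiv.symm_swap, Equiv.swap_apply_right] at ha
    exact Nat.not_lt_zero _ ha
  · exact ⟨w, fun x hx => absurd ⟨x, hx⟩ h⟩

/-- For a graph joined from pieces at single vertices, the product of the elements `Q` of the pieces
is the gcd of the determinants of families of splines.  The vertices are ranked by the first piece
containing them and then by the order within that piece; if the order of each piece starts with its
attaching vertex, the pivots of the pieces are pivots of the whole graph. -/
theorem IsVertexJoin.isDetGcd [IsDomain R] [GCDMonoid R] [Fintype V] [DecidableEq V]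
    (hG : IsVertexJoin G H) (l : Sym2 V → R) {m : Fin k → ℕ}
    (w : ∀ i, Fin (m i) ≃ (H i).verts) :
    IsDetGcd (splineModule G fun e => Ideal.span {l e})
      (∏ i, elementQ (H i).coe (restrictLabels (H i) l) (w i)) := by
  classical
  choose w' hw' using fun i => hG.exists_ordering (w i)
  suffices h : IsDetGcd (splineModule G fun e => Ideal.span {l e})
      (∏ i, elementQ (H i).coe (restrictLabels (H i) l) (w' i)) from
    h.of_associated (Associated.prod _ _ _ fun i _ => associated_elementQ _ _ _ _)
  have hcov : ∀ u : V, ∃ i, u ∈ (H i).verts ∧ ∀ j < i, u ∉ (H j).verts := by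
    intro u
    have : u ∈ (⨆ i, H i).verts := by rw [hG.cover]; trivial
    obtain ⟨i, hi⟩ : ∃ i, u ∈ (H i).verts := by simpa using this
    obtain ⟨i, hi, hmin⟩ := WellFounded.has_min wellFounded_lt {i | u ∈ (H i).verts} ⟨i, hi⟩
    exact ⟨i, hi, fun j hj hu => hmin j hu hj⟩
  choose idx hidx hlt using hcov
  let pos : Fin k → V → ℕ := fun i x =>
    if h : x ∈ (H i).verts then ((w' i).symm ⟨x, h⟩).val else 0
  let fac : Fin k → V → R := fun i x =>
    if h : x ∈ (H i).verts then
      trailLcm (H i).coe (restrictLabels (H i) l) (w' i) ((w' i).symm ⟨x, h⟩) else 1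
  have hpos : ∀ i (x : (H i).verts), pos i x = (w' i).symm x := fun i x => dif_pos x.2
  have hfac : ∀ i (x : (H i).verts),
      fac i x = trailLcm (H i).coe (restrictLabels (H i) l) (w' i) ((w' i).symm x) :=
    fun i x => dif_pos x.2
  have hidx_le : ∀ i, ∀ x ∈ (H i).verts, idx x ≤ i := fun i x hx =>
    not_lt.1 fun h => hlt x i h hx
  let ρ : V → Fin k ×ₗ ℕ := fun u => toLex (idx u, pos (idx u) u)
  have hρlt : ∀ u b, ρ b < ρ u ↔ idx b < idx u ∨ idx b = idx u ∧ pos (idx b) b < pos (idx u) u :=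
    fun u b => Prod.Lex.toLex_lt_toLex
  have hρ : Function.Injective ρ := by
    intro u u' h
    obtain ⟨h1, h2⟩ := Prod.mk.inj (toLex.injective h)
    rw [h1] at h2
    have hu : u ∈ (H (idx u')).verts := h1 ▸ hidx u
    have h3 := (hpos _ ⟨u, hu⟩).symm.trans (h2.trans (hpos _ ⟨u', hidx u'⟩))
    exact congrArg Subtype.val ((w' _).symm.injective (Fin.ext h3))
  have hpivot : ∀ u, IsPivot (splineModule G fun e => Ideal.span {l e}) ρ u (fac (idx u) u) := by
    intro u
    have hp := isPivot_trailLcm (H (idx u)).coe (restrictLabels (H (idx u)) l) (w' (idx u))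
      ⟨u, hidx u⟩
    rw [← hfac] at hp
    refine ⟨fun c hc => hp.dvd_of_forall c fun g b hb hg => hc g b ?_ fun f hf => ?_,
      fun d hd => hp.forall_dvd d fun f hf hf0 => ?_⟩
    · rw [hρlt]
      rcases (hidx_le _ _ b.2).lt_or_eq with h | h
      · exact Or.inl h
      · refine Or.inr ⟨h, ?_⟩
        rw [h, hpos, hpos _ ⟨u, hidx u⟩]
        exact hb
    · refine hg (fun x => f x) (mem_splineModule_span.2 fun x y hxy => ?_)
      exact mem_splineModule_span.1 hf x y hxy.adj_sub
    · rw [mem_splineModule_span] at hf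
      have hshared : ∀ x : (H (idx u)).verts, (∃ j < idx u, x.1 ∈ (H j).verts) → f x = 0 := by
        intro x hx
        refine hf0 x (lt_of_le_of_ne (not_lt.1 (hw' _ x hx _)) fun h => ?_)
        obtain rfl := (w' _).symm.injective h
        obtain ⟨j, hj, hxj⟩ := hx
        exact hlt u j hj hxj
      let g : V → R := fun x => if h : x ∈ (H (idx u)).verts then f ⟨x, h⟩ else 0
      have hg : ∀ x : (H (idx u)).verts, g x = f x := fun x => dif_pos x.2
      have hg0 : ∀ j < idx u, ∀ x ∈ (H j).verts, g x = 0 := by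
        intro j hj x hx
        by_cases h : x ∈ (H (idx u)).verts
        · exact (hg ⟨x, h⟩).trans (hshared ⟨x, h⟩ ⟨j, hj, hx⟩)
        · exact dif_neg h
      obtain ⟨f', hf', hf'g⟩ := hG.exists_extension (l := l) (f := g) (fun x y hxy => by
        have := hf ⟨x, (H _).edge_vert hxy⟩ ⟨y, (H _).edge_vert hxy.symm⟩ hxy
        rwa [← hg, ← hg] at this) hg0
      have := hd f' hf' fun b hb => ?_
      · rwa [hf'g _ le_rfl u (hidx u), hg ⟨u, hidx u⟩] at this
      · rcases (hρlt _ _).1 hb with h | ⟨h, h'⟩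
        · rw [hf'g _ h.le b (hidx b), hg0 _ h b (hidx b)]
        · have hbu : b ∈ (H (idx u)).verts := h ▸ hidx b
          rw [hf'g _ le_rfl b hbu, hg ⟨b, hbu⟩]
          refine hf0 _ ?_
          rwa [h, hpos _ ⟨b, hbu⟩, hpos _ ⟨u, hidx u⟩] at h'
  -- A vertex contributes the factor `1` to all pieces but the first one containing it.
  have hprod : ∏ i, elementQ (H i).coe (restrictLabels (H i) l) (w' i) = ∏ u, fac (idx u) u := by
    have h1 : ∀ i, elementQ (H i).coe (restrictLabels (H i) l) (w' i) = ∏ u, fac i u := by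
      intro i
      refine Fintype.prod_of_injective (fun a => (w' i a : V))
        (Subtype.val_injective.comp (w' i).injective) _ _ (fun x hx => dif_neg fun h => hx ?_)
        fun a => ?_
      · exact ⟨(w' i).symm ⟨x, h⟩, by simp⟩
      · rw [hfac, Equiv.symm_apply_apply]; rfl
    rw [Finset.prod_congr rfl fun i _ => h1 i, Finset.prod_comm]
    refine Finset.prod_congr rfl fun u _ => Fintype.prod_eq_single _ fun i hi => ?_
    by_cases h : u ∈ (H i).verts
    · rw [hfac i ⟨u, h⟩]
      exact trailLcm_eq_one (hw' i ⟨u, h⟩ ⟨idx u, lt_of_le_of_ne (hidx_le i u h) hi.symm, hidx u⟩)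
    · exact dif_neg h
  rw [hprod]
  exact isDetGcd_prod_of_isPivot hρ hpivot

end Join

end GraphSpline

theorem corollary3p20 {R V : Type*} [CommRing R] [IsDomain R] [GCDMonoid R]
    {n k : ℕ} (G : SimpleGraph V) (v : Fin n ≃ V)
    (l : Sym2 V → R) (hl : ∀ e ∈ G.edgeSet, l e ≠ 0)
    (H : Fin k → G.Subgraph)
    (hH : ∀ i, GraphSpline.IsCycleGraph (H i).coe ∨ GraphSpline.IsDiamondGraph (H i).coe ∨
      (H i).coe.IsTree)
    (hG : GraphSpline.IsVertexJoin G H)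
    (m : Fin k → ℕ) (w : ∀ i, Fin (m i) ≃ (H i).verts)
    (F : Fin n → GraphSpline.splineModule G fun e => Ideal.span {l e}) :
    (LinearIndependent R F ∧ Submodule.span R (Set.range F) = ⊤) ↔
      ∃ r : Rˣ, (GraphSpline.splineMatrix v fun b => (F b : V → R)).det =
        r * ∏ i, GraphSpline.elementQ (H i).coe (GraphSpline.restrictLabels (H i) l) (w i) := by
  classical
  have : Fintype V := Fintype.ofEquiv _ v
  have hq0 : ∏ i, GraphSpline.elementQ (H i).coe (GraphSpline.restrictLabels (H i) l) (w i) ≠ 0 := by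
    refine Finset.prod_ne_zero_iff.2 fun i _ => Finset.prod_ne_zero_iff.2 fun a _ =>
      GraphSpline.trailLcm_ne_zero (fun e he => ?_) (w i) a
    induction e with
    | _ x y => exact hl _ (SimpleGraph.Subgraph.Adj.adj_sub he)
  -- Index the columns by the vertices through the bottom-to-top order that indexes the rows.
  let e : Fin n ≃ V := Fin.revPerm.trans v
  have hF := (hG.isDetGcd l w).basis_iff hq0 (F ∘ e.symm)
  have hdet : (GraphSpline.splineMatrix v fun b => (F b : V → R)).det =
      (GraphSpline.colMatrix fun u => ((F ∘ e.symm) u : V → R)).det := by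
    rw [← Matrix.det_submatrix_equiv_self e]
    congr 1
    ext a b
    simp [GraphSpline.splineMatrix, GraphSpline.colMatrix, e]
  rw [linearIndependent_equiv, e.symm.surjective.range_comp] at hF
  rw [hF, hdet]
  constructor
  · rintro ⟨r, hr⟩
    exact ⟨r, by rw [← hr, mul_comm]⟩
  · rintro ⟨r, hr⟩
    exact ⟨r, by rw [hr, mul_comm]⟩
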